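/- Let $\mathbb{S}_d^+\subset M_d(\mathbb{R})$ be the cone of symmetric positive semidefinite real $d\times d$ matrices and let $\|\cdot\|$ be any norm on $M_d(\mathbb{R})$. Let $L=(L_t)_{t\ge 0}$ be a matrix subordinator, i.e. a Lévy process with values in the symmetric real $d\times d$ matrices such that $L_t-L_s\in\mathbb{S}_d^+$ almost surely for all $t>s$. Let $\gamma_L\in\mathbb{S}_d^+$ be its drift and $\kappa_L$ its Lévy measure, so that $\kappa_L$ is concentrated on $\mathbb{S}_d^+$, $\kappa_L(\{0\})=0$, $\int\min(1,\|X\|^2)\,\kappa_L(dX)<\infty$, $\int_{\{\|X\|\le 1\}}\|X\|\,\kappa_L(dX)<\infty$, and \[ E\big[e^{i\,\mathrm{tr}(ZL_1)}\big]=\exp\Big(i\,\mathrm{tr}(\gamma_L Z)+\int_{\mathbb{S}_d^+}\big(e^{i\,\mathrm{tr}(XZ)}-1\big)\,\kappa_L(dX)\Big),\qquad Z\in M_d(\mathbb{R}). \] Let \[ \Theta_L(Z)=\mathrm{tr}(\gamma_L Z)+\int_{\mathbb{S}_d^+}\big(e^{\mathrm{tr}(XZ)}-1\big)\,\kappa_L(dX)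 \] be the cumulant transform of $L$, defined for those $Z\in M_d(\mathbb{C})$ for which the integral converges absolutely; this includes all $Z\in iM_d(\mathbb{R})$. Let $\epsilon>0$ and \[ S_\epsilon:=\{Z\in M_d(\mathbb{C}):\|\Re Z\|<\epsilon\}-\mathbb{S}_d^+=\{W-P:\ W\in M_d(\mathbb{C}),\ \|\Re W\|<\epsilon,\ P\in\mathbb{S}_d^+\}, \] where $\Re$ is taken entrywise. Then $S_\epsilon$ is open and convex, and the following are equivalent: \begin{enumerate} \item $\Theta_L$ is analytic on $S_\epsilon$, i.e. the integral defining $\Theta_L(Z)$ converges absolutely for every $Z\in S_\epsilon$, and $\Theta_L$ is analytic on $S_\epsilon$; \item the restriction of $\Theta_L$ to $iM_d(\mathbb{R})$ extends to an analytic function on $S_\epsilon$; \item $\displaystyle\int_{\{\|X\|\ge 1\}}e^{\mathrm{tr}(RX)}\,\kappa_L(dX)<\infty$ for all $R\in M_d(\mathbb{R})$ with $\|R\|<\epsilon$. \end{enumerate} -/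

import Mathlib

open MeasureTheory ProbabilityTheory Filter Topology
open scoped NNReal ENNReal Pointwise

/-- Real square matrices carry their Borel sigma-algebra. -/
instance matrixMeasurableSpace (d : ℕ) : MeasurableSpace (Matrix (Fin d) (Fin d) ℝ) :=
  borel _

instance matrixBorelSpace (d : ℕ) : BorelSpace (Matrix (Fin d) (Fin d) ℝ) := ⟨rfl⟩

-- Matrices are normed by the Frobenius norm, wherever Mathlib asks for some norm.
attribute [local instance] Matrix.frobeniusNormedAddCommGroup Matrix.frobeniusNormedSpace

/-- A Lévy process with values in `E`, indexed by `[0, ∞)`. -/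
structure IsLevyProcess {Ω E : Type*} [MeasurableSpace Ω] [NormedAddCommGroup E]
    [MeasurableSpace E] (L : ℝ≥0 → Ω → E) (P : Measure Ω) : Prop where
  measurable : ∀ t, Measurable (L t)
  start_zero : ∀ᵐ ω ∂P, L 0 ω = 0
  indep_increments : HasIndepIncrements L P
  stationary_increments : ∀ s t : ℝ≥0,
    IdentDistrib (fun ω => L (s + t) ω - L s ω) (fun ω => L t ω - L 0 ω) P P
  stochastically_continuous : ∀ t, TendstoInMeasure P L (𝓝 t) (L t)
  /-- Almost all paths are right-continuous with left limits. -/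
  cadlag : ∀ᵐ ω ∂P, ∀ t : ℝ≥0,
    ContinuousWithinAt (fun s => L s ω) (Set.Ici t) t ∧
      ∃ l : E, Tendsto (fun s => L s ω) (𝓝[<] t) (𝓝 l)

/-- A matrix subordinator: a Lévy process of symmetric matrices with positive semidefinite
increments. -/
structure IsMatrixSubordinator {d : ℕ} {Ω : Type*} [MeasurableSpace Ω]
    (L : ℝ≥0 → Ω → Matrix (Fin d) (Fin d) ℝ) (P : Measure Ω) : Prop where
  isLevyProcess : IsLevyProcess L P
  symm : ∀ t ω, (L t ω).IsSymm
  increments : ∀ s t : ℝ≥0, s < t → ∀ᵐ ω ∂P, (L t ω - L s ω).PosSemidef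

noncomputable section

/-- A real matrix regarded as a complex one. -/
def toComplexMatrix {d : ℕ} (X : Matrix (Fin d) (Fin d) ℝ) : Matrix (Fin d) (Fin d) ℂ :=
  X.map (fun x => (x : ℂ))

/-- `ψ(Z) = i tr(γ Z) + ∫ (exp(i tr(X Z)) - 1) κ(dX)`, the integral over the positive semidefinite
matrices. -/
def charExponent {d : ℕ} (γ : Matrix (Fin d) (Fin d) ℝ)
    (κ : Measure (Matrix (Fin d) (Fin d) ℝ)) (Z : Matrix (Fin d) (Fin d) ℂ) : ℂ :=
  Complex.I * (toComplexMatrix γ * Z).trace +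
    ∫ X in {X : Matrix (Fin d) (Fin d) ℝ | X.PosSemidef},
      (Complex.exp (Complex.I * (toComplexMatrix X * Z).trace) - 1) ∂κ

/-- The integrand `exp(tr(X Z)) - 1` of the cumulant transform. -/
def cumulantIntegrand {d : ℕ} (Z : Matrix (Fin d) (Fin d) ℂ) (X : Matrix (Fin d) (Fin d) ℝ) : ℂ :=
  Complex.exp (toComplexMatrix X * Z).trace - 1

/-- `Θ(Z) = tr(γ Z) + ∫ (exp(tr(X Z)) - 1) κ(dX)`, the integral over the positive semidefinite
matrices; meaningful for those `Z` at which the integrand is integrable. -/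
def cumulantTransform {d : ℕ} (γ : Matrix (Fin d) (Fin d) ℝ)
    (κ : Measure (Matrix (Fin d) (Fin d) ℝ)) (Z : Matrix (Fin d) (Fin d) ℂ) : ℂ :=
  (toComplexMatrix γ * Z).trace +
    ∫ X in {X : Matrix (Fin d) (Fin d) ℝ | X.PosSemidef}, cumulantIntegrand Z X ∂κ

theorem cumulantTransform_eq_charExponent {d : ℕ} (γ : Matrix (Fin d) (Fin d) ℝ)
    (κ : Measure (Matrix (Fin d) (Fin d) ℝ)) (Z : Matrix (Fin d) (Fin d) ℂ) :
    cumulantTransform γ κ Z = charExponent γ κ (-Complex.I • Z) := by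
  have h : ∀ a : ℂ, Complex.I * (-Complex.I * a) = a := fun a => by
    rw [← mul_assoc, mul_neg, Complex.I_mul_I, neg_neg, one_mul]
  simp only [cumulantTransform, charExponent, cumulantIntegrand, Matrix.mul_smul,
    Matrix.trace_smul, smul_eq_mul, h]

/-- `γ` and `κ` are the drift and the Lévy measure of the matrix subordinator `L`: `γ` is positive
semidefinite, `κ` is a Lévy measure concentrated on the positive semidefinite matrices with
`∫_{‖X‖ ≤ 1} ‖X‖ κ(dX) < ∞`, and `E exp(i tr(Z L₁)) = exp(ψ(Z))` for all real `Z`. Here `N` is the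
norm on real matrices. -/
structure HasDriftAndLevyMeasure {d : ℕ} {Ω : Type*} [MeasurableSpace Ω]
    (N : Seminorm ℝ (Matrix (Fin d) (Fin d) ℝ))
    (L : ℝ≥0 → Ω → Matrix (Fin d) (Fin d) ℝ) (P : Measure Ω)
    (γ : Matrix (Fin d) (Fin d) ℝ) (κ : Measure (Matrix (Fin d) (Fin d) ℝ)) : Prop where
  drift_posSemidef : γ.PosSemidef
  levy_zero : κ {0} = 0
  levy_sq : ∫⁻ X, ENNReal.ofReal (min 1 (N X ^ 2)) ∂κ < ∞
  levy_posSemidef : κ {X | ¬ X.PosSemidef} = 0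
  levy_small : ∫⁻ X in {X | N X ≤ 1}, ENNReal.ofReal (N X) ∂κ < ∞
  charFun_eq : ∀ Z : Matrix (Fin d) (Fin d) ℝ,
    ∫ ω, Complex.exp (Complex.I * (((Z * L 1 ω).trace : ℝ) : ℂ)) ∂P =
      Complex.exp (charExponent γ κ (toComplexMatrix Z))

/-- `S_ε = {Z : ‖Re Z‖ < ε} - {positive semidefinite real matrices}`, a Minkowski difference. -/
def stripMinusCone {d : ℕ} (N : Seminorm ℝ (Matrix (Fin d) (Fin d) ℝ)) (ε : ℝ) :
    Set (Matrix (Fin d) (Fin d) ℂ) :=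
  {Z | N (Z.map Complex.re) < ε} -
    toComplexMatrix '' {X : Matrix (Fin d) (Fin d) ℝ | X.PosSemidef}

/-- `∫_{‖X‖ ≥ 1} exp(tr(R X)) κ(dX) < ∞` for all real matrices `R` with `‖R‖ < ε`. -/
def FiniteExpMoments {d : ℕ} (N : Seminorm ℝ (Matrix (Fin d) (Fin d) ℝ))
    (κ : Measure (Matrix (Fin d) (Fin d) ℝ)) (ε : ℝ) : Prop :=
  ∀ R : Matrix (Fin d) (Fin d) ℝ, N R < ε →
    ∫⁻ X in {X | 1 ≤ N X}, ENNReal.ofReal (Real.exp (R * X).trace) ∂κ < ∞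

/-- `Θ` is defined by an absolutely convergent integral at each point of `S`, and is analytic
on `S`. -/
def CumulantAnalyticOn {d : ℕ} (γ : Matrix (Fin d) (Fin d) ℝ)
    (κ : Measure (Matrix (Fin d) (Fin d) ℝ)) (S : Set (Matrix (Fin d) (Fin d) ℂ)) : Prop :=
  (∀ Z ∈ S, IntegrableOn (cumulantIntegrand Z)
    {X : Matrix (Fin d) (Fin d) ℝ | X.PosSemidef} κ) ∧
  AnalyticOnNhd ℂ (cumulantTransform γ κ) S

/-- `Θ`, which is always defined on `i M_d(ℝ)`, has an analytic extension from there to `S`. -/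
def CumulantExtendsAnalyticallyTo {d : ℕ} (γ : Matrix (Fin d) (Fin d) ℝ)
    (κ : Measure (Matrix (Fin d) (Fin d) ℝ)) (S : Set (Matrix (Fin d) (Fin d) ℂ)) : Prop :=
  ∃ F : Matrix (Fin d) (Fin d) ℂ → ℂ, AnalyticOnNhd ℂ F S ∧
    ∀ Y : Matrix (Fin d) (Fin d) ℝ,
      F (Complex.I • toComplexMatrix Y) = cumulantTransform γ κ (Complex.I • toComplexMatrix Y)

end

/-! The implications run (3) ⇒ (1) ⇒ (2) ⇒ (3); the middle one is immediate.

(3) ⇒ (1). If `X` and `P` are positive semidefinite then `tr(PX) ≥ 0`, so subtracting `P` from `W`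
only lowers `Re tr(XW)` (`re_tracePairing_sub_le`). Hence `exp(Re tr(XZ))` is integrable over the
large jumps for every `Z` in the set. The set is open, so it also contains `Z + δI` for some `δ >
0`. The extra factor `exp(δ tr X)` controls `exp(c ‖tr(X ·)‖)`, because the trace bounds the norm on
the cone. The Taylor series of the integrand at `Z` can then be integrated term by term
(`analyticAt_integral_cexp_sub_one`). Small jumps are handled by integrability of the norm.

(2) ⇒ (3). Fix `R` and restrict the extension to the complex line `z R`. Removing the drift and the
small-jump integral, which is entire, and adding the mass of the large jumps leaves an analytic
extension of the characteristic function of a finite measure on `ℝ`: the image of the large jumps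
under `tr(R ·)`. It is analytic on a disc of radius `a > 1`. Cauchy's estimates bound the even
moments, and summing the cosh series gives the exponential moment at `1`
(`lintegral_exp_lt_top_of_charFun_eq_analyticOn`). -/

/-! ### Analyticity of integrals of exponentials. -/

theorem sum_range_pow_succ_div_factorial_le {t : ℝ} (ht : 0 ≤ t) (n : ℕ) :
    ∑ k ∈ Finset.range n, t ^ (k + 1) / (k + 1).factorial ≤ Real.exp t - 1 := by
  have h := Real.sum_le_exp_of_nonneg ht (n + 1)
  rw [Finset.sum_range_succ'] at h
  simp only [pow_zero, Nat.factorial_zero, Nat.cast_one, div_one] at h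
  linarith

/-- The `n`-th term of the Taylor expansion of `z ↦ exp (ℓ z) - 1` at `z₀`. -/
noncomputable def expSubOneSeries {E : Type*} [NormedAddCommGroup E] [NormedSpace ℂ E] (z₀ : E)
    (n : ℕ) (ℓ : E →L[ℂ] ℂ) : E [×n]→L[ℂ] ℂ :=
  (Complex.exp (ℓ z₀) / n.factorial - if n = 0 then 1 else 0) •
    (ContinuousMultilinearMap.mkPiAlgebraFin ℂ n ℂ).compContinuousLinearMap fun _ => ℓ

section expSubOneSeries

variable {E : Type*} [NormedAddCommGroup E] [NormedSpace ℂ E]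

theorem continuous_expSubOneSeries (z₀ : E) (n : ℕ) : Continuous (expSubOneSeries z₀ n) := by
  unfold expSubOneSeries
  have h₁ : Continuous fun ℓ : E →L[ℂ] ℂ =>
      Complex.exp (ℓ z₀) / n.factorial - if n = 0 then 1 else 0 := by fun_prop
  refine h₁.smul ?_
  have h₂ := (ContinuousMultilinearMap.compContinuousLinearMapContinuousMultilinear ℂ
    (fun _ : Fin n => E) (fun _ : Fin n => ℂ) ℂ).cont
  exact (h₂.comp (continuous_pi fun _ => continuous_id)).clm_apply continuous_const

theorem expSubOneSeries_apply (z₀ : E) (n : ℕ) (ℓ : E →L[ℂ] ℂ) (y : E) :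
    expSubOneSeries z₀ n ℓ (fun _ => y) =
      (Complex.exp (ℓ z₀) / n.factorial - if n = 0 then 1 else 0) * ℓ y ^ n := by
  simp [expSubOneSeries, List.ofFn_const]

theorem hasSum_expSubOneSeries (z₀ : E) (ℓ : E →L[ℂ] ℂ) (y : E) :
    HasSum (fun n => expSubOneSeries z₀ n ℓ fun _ => y) (Complex.exp (ℓ (z₀ + y)) - 1) := by
  have h1 := (NormedSpace.expSeries_div_hasSum_exp (ℓ y)).mul_left (Complex.exp (ℓ z₀))
  rw [← Complex.exp_eq_exp_ℂ, ← Complex.exp_add, ← map_add] at h1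
  refine (h1.sub (hasSum_ite_eq (0 : ℕ) (1 : ℂ))).congr_fun ?_
  intro n
  rw [expSubOneSeries_apply]
  rcases n with _ | n
  · simp
  · simp; ring

/-- The constant term is estimated separately: for an infinite measure `exp (ℓ z₀)` alone need not
be integrable, so the `-1` must stay with it. -/
theorem norm_expSubOneSeries_zero_le (z₀ : E) (ℓ : E →L[ℂ] ℂ) :
    ‖expSubOneSeries z₀ 0 ℓ‖ ≤ ‖Complex.exp (ℓ z₀) - 1‖ := by
  have h := ContinuousMultilinearMap.norm_compContinuousLinearMap_le
    (ContinuousMultilinearMap.mkPiAlgebraFin ℂ 0 ℂ) (fun _ => ℓ)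
  simp only [ContinuousMultilinearMap.norm_mkPiAlgebraFin, Finset.univ_eq_empty,
    Finset.prod_empty, mul_one] at h
  rw [expSubOneSeries, norm_smul]
  simpa using mul_le_mul_of_nonneg_left h (norm_nonneg (Complex.exp (ℓ z₀) - 1))

theorem norm_expSubOneSeries_succ_le (z₀ : E) (n : ℕ) (ℓ : E →L[ℂ] ℂ) :
    ‖expSubOneSeries z₀ (n + 1) ℓ‖ ≤
      Real.exp (ℓ z₀).re * (‖ℓ‖ ^ (n + 1) / (n + 1).factorial) := by
  have h := ContinuousMultilinearMap.norm_compContinuousLinearMap_le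
    (ContinuousMultilinearMap.mkPiAlgebraFin ℂ (n + 1) ℂ) (fun _ => ℓ)
  simp only [ContinuousMultilinearMap.norm_mkPiAlgebraFin, one_mul, Finset.prod_const,
    Finset.card_univ, Fintype.card_fin] at h
  rw [expSubOneSeries, norm_smul]
  simp only [Nat.add_eq_zero_iff, one_ne_zero, and_false, if_false, sub_zero, norm_div,
    Complex.norm_exp, Complex.norm_natCast]
  calc _ ≤ Real.exp (ℓ z₀).re / (n + 1).factorial * ‖ℓ‖ ^ (n + 1) := by gcongr
    _ = _ := by ring

/-- An integral of functions `z ↦ exp (ℓ z) - 1` is analytic at a point around which the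
integrands are dominated. -/
theorem analyticAt_integral_cexp_sub_one {α : Type*} [MeasurableSpace α] {μ : Measure α}
    {ℓ : α → E →L[ℂ] ℂ} (hℓ : AEStronglyMeasurable ℓ μ) {z₀ : E} {c : ℝ} (hc : 0 < c)
    (h₀ : Integrable (fun x => Complex.exp (ℓ x z₀) - 1) μ)
    (h₁ : Integrable (fun x => Real.exp (ℓ x z₀).re * (Real.exp (c * ‖ℓ x‖) - 1)) μ) :
    AnalyticAt ℂ (fun z => ∫ x, (Complex.exp (ℓ x z) - 1) ∂μ) z₀ := by
  have hmeas : ∀ n, AEStronglyMeasurable (fun x => expSubOneSeries z₀ n (ℓ x)) μ := fun n =>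
    (continuous_expSubOneSeries z₀ n).comp_aestronglyMeasurable hℓ
  have hre : AEStronglyMeasurable (fun x => Real.exp (ℓ x z₀).re) μ := by
    have : Continuous fun l : E →L[ℂ] ℂ => Real.exp (l z₀).re := by fun_prop
    exact this.comp_aestronglyMeasurable hℓ
  -- `B n` dominates the Taylor term of degree `n + 1` on the ball of radius `c`; all partial sums
  -- of the `B n` lie below the integrand of `h₁`.
  set B : ℕ → α → ℝ := fun n x =>
    Real.exp (ℓ x z₀).re * ((c * ‖ℓ x‖) ^ (n + 1) / (n + 1).factorial) with hB
  have hBnn : ∀ n x, 0 ≤ B n x := fun n x => by positivity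
  have hBsum : ∀ n x, ∑ k ∈ Finset.range n, B k x ≤
      Real.exp (ℓ x z₀).re * (Real.exp (c * ‖ℓ x‖) - 1) := fun n x => by
    rw [hB, ← Finset.mul_sum]
    exact mul_le_mul_of_nonneg_left
      (sum_range_pow_succ_div_factorial_le (by positivity) n) (Real.exp_nonneg _)
  have hBint : ∀ n, Integrable (B n) μ := fun n => by
    have hpow : Continuous fun l : E →L[ℂ] ℂ => (c * ‖l‖) ^ (n + 1) / (n + 1).factorial := by
      fun_prop
    refine h₁.mono' (hre.mul (hpow.comp_aestronglyMeasurable hℓ)) (ae_of_all _ fun x => ?_)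
    rw [Real.norm_of_nonneg (hBnn n x)]
    refine le_trans ?_ (hBsum (n + 1) x)
    exact Finset.single_le_sum (f := fun k => B k x) (fun k _ => hBnn k x)
      (Finset.self_mem_range_succ n)
  have hBsummable : Summable fun n => ∫ x, B n x ∂μ := by
    refine summable_of_sum_range_le (c := ∫ x, Real.exp (ℓ x z₀).re *
      (Real.exp (c * ‖ℓ x‖) - 1) ∂μ) (fun n => integral_nonneg (hBnn n)) fun n => ?_
    rw [← integral_finsetSum _ fun k _ => hBint k]
    exact integral_mono (integrable_finsetSum _ fun k _ => hBint k) h₁ (hBsum n)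
  have hle : ∀ n x, ‖expSubOneSeries z₀ (n + 1) (ℓ x)‖ * c ^ (n + 1) ≤ B n x := fun n x => by
    refine (mul_le_mul_of_nonneg_right (norm_expSubOneSeries_succ_le z₀ n (ℓ x))
      (by positivity)).trans_eq ?_
    rw [hB]; ring
  have hint : ∀ n, Integrable (fun x => expSubOneSeries z₀ n (ℓ x)) μ := by
    rintro (_ | n)
    · exact h₀.norm.mono' (hmeas 0) (ae_of_all _ fun x => norm_expSubOneSeries_zero_le z₀ (ℓ x))
    · refine ((hBint n).div_const (c ^ (n + 1))).mono' (hmeas _) (ae_of_all _ fun x => ?_)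
      rw [le_div_iff₀ (by positivity)]
      exact hle n x
  have hnorm : ∀ n, (∫ x, ‖expSubOneSeries z₀ (n + 1) (ℓ x)‖ ∂μ) * c ^ (n + 1) ≤
      ∫ x, B n x ∂μ := fun n => by
    rw [← integral_mul_const]
    exact integral_mono ((hint _).norm.mul_const _) (hBint n) (hle n)
  refine ⟨fun n => ∫ x, expSubOneSeries z₀ n (ℓ x) ∂μ, ENNReal.ofReal c, ?_, by simpa, ?_⟩
  · refine FormalMultilinearSeries.le_radius_of_summable_norm _ (r := c.toNNReal) ?_
    rw [← summable_nat_add_iff 1]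
    refine hBsummable.of_nonneg_of_le (fun n => by positivity) fun n => ?_
    rw [Real.coe_toNNReal _ hc.le]
    exact (mul_le_mul_of_nonneg_right (norm_integral_le_integral_norm _) (by positivity)).trans
      (hnorm n)
  · intro y hy
    have hy' : ‖y‖ ≤ c := by
      rw [Metric.eball_ofReal] at hy
      exact (mem_ball_zero_iff.1 hy).le
    have hval : ∀ n x, ‖expSubOneSeries z₀ n (ℓ x) fun _ => y‖ ≤
        ‖expSubOneSeries z₀ n (ℓ x)‖ * c ^ n := fun n x => by
      refine ((expSubOneSeries z₀ n (ℓ x)).le_opNorm _).trans ?_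
      simp only [Finset.prod_const, Finset.card_univ, Fintype.card_fin]
      gcongr
    have happ : ∀ n, Integrable (fun x => expSubOneSeries z₀ n (ℓ x) fun _ => y) μ := fun n =>
      (ContinuousMultilinearMap.apply ℂ (fun _ : Fin n => E) ℂ (fun _ => y)).integrable_comp
        (hint n)
    have hsum := hasSum_integral_of_summable_integral_norm happ ?_
    · simp only [(hasSum_expSubOneSeries z₀ _ y).tsum_eq] at hsum
      refine hsum.congr_fun fun n => ?_
      exact ((ContinuousMultilinearMap.apply ℂ (fun _ : Fin n => E) ℂ
        (fun _ => y)).integral_comp_comm (hint n)).symm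
    · rw [← summable_nat_add_iff 1]
      refine hBsummable.of_nonneg_of_le (fun n => by positivity) fun n => ?_
      refine le_trans ?_ (hnorm n)
      rw [← integral_mul_const]
      exact integral_mono (happ _).norm ((hint _).norm.mul_const _) (hval _)

end expSubOneSeries

/-! ### Exponential moments from analytic characteristic functions. -/

theorem integrable_one_sub_cos (μ : Measure ℝ) [IsFiniteMeasure μ] (t : ℝ) :
    Integrable (fun x => 2 * (1 - Real.cos (t * x))) μ := by
  refine (integrable_const (4 : ℝ)).mono' (by fun_prop) (ae_of_all _ fun x => ?_)
  rw [Real.norm_eq_abs, abs_le]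
  constructor <;> linarith [Real.cos_le_one (t * x), Real.neg_one_le_cos (t * x)]

/-- The symmetric difference has a nonnegative integrand, which makes Fatou's lemma available. -/
theorem charFun_second_difference (μ : Measure ℝ) [IsFiniteMeasure μ] (t : ℝ) :
    2 * charFun μ 0 - charFun μ t - charFun μ (-t) =
      ((∫ x, 2 * (1 - Real.cos (t * x)) ∂μ : ℝ) : ℂ) := by
  have hi : ∀ s : ℝ, Integrable (fun x : ℝ => Complex.exp (s * x * Complex.I)) μ := fun s => by
    refine (integrable_const (1 : ℝ)).mono' (by fun_prop) (ae_of_all _ fun x => ?_)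
    rw [← Complex.ofReal_mul, Complex.norm_exp_ofReal_mul_I]
  have h₁ : Integrable (fun x : ℝ => 2 * Complex.exp ((0 : ℝ) * x * Complex.I) -
      Complex.exp (t * x * Complex.I)) μ := ((hi 0).const_mul 2).sub (hi t)
  simp only [charFun_apply_real]
  rw [← integral_const_mul, ← integral_sub ((hi 0).const_mul 2) (hi t),
    ← integral_sub h₁ (hi (-t)), ← integral_complex_ofReal]
  refine integral_congr_ae (ae_of_all _ fun x => ?_)
  push_cast
  rw [Complex.cos]
  simp only [zero_mul, Complex.exp_zero, neg_mul]
  ring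

/-- The constant and linear Taylor terms cancel. -/
theorem isBigO_second_difference {g : ℂ → ℂ} (hg : AnalyticAt ℂ g 0) :
    (fun z => 2 * g 0 - g z - g (-z)) =O[𝓝 0] fun z => ‖z‖ ^ 2 := by
  obtain ⟨p, hp⟩ := hg
  have h := hp.isBigO_sub_partialSum_pow 2
  have hneg : Tendsto (fun z : ℂ => -z) (𝓝 0) (𝓝 0) := by
    simpa using (continuous_neg (G := ℂ)).tendsto 0
  have h' := h.comp_tendsto hneg
  have h0 : p.coeff 0 = g 0 := hp.coeff_zero _
  refine ((h.add (h'.congr_right fun z => by simp)).neg_left).congr_left fun z => ?_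
  simp only [FormalMultilinearSeries.partialSum, Finset.sum_range_succ, Finset.range_zero,
    Finset.sum_empty, Function.comp_apply, FormalMultilinearSeries.apply_eq_pow_smul_coeff, h0,
    zero_add, pow_zero, pow_one, smul_eq_mul, one_mul]
  ring

/-- The quotient equals `x² sinc²(tx/2)`. -/
theorem tendsto_second_difference_cos (x : ℝ) :
    Tendsto (fun t : ℝ => 2 * (1 - Real.cos (t * x)) / t ^ 2) (𝓝[≠] 0) (𝓝 (x ^ 2)) := by
  have h1 : Tendsto (fun t : ℝ => Real.sinc (t * x / 2)) (𝓝[≠] 0) (𝓝 1) := by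
    have : Continuous fun t : ℝ => Real.sinc (t * x / 2) := by fun_prop
    simpa using (this.tendsto 0).mono_left nhdsWithin_le_nhds
  have h2 := (h1.pow 2).const_mul (x ^ 2)
  rw [one_pow, mul_one] at h2
  refine h2.congr' (eventually_mem_nhdsWithin.mono fun t (ht : t ≠ 0) => ?_)
  rcases eq_or_ne x 0 with rfl | hx
  · simp
  have hc : Real.cos (t * x) = 1 - 2 * Real.sin (t * x / 2) ^ 2 := by
    have := Real.cos_two_mul (t * x / 2)
    rw [mul_div_cancel₀ _ two_ne_zero] at this
    rw [this, Real.cos_sq']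
    ring
  beta_reduce
  rw [Real.sinc_of_ne_zero (by positivity), hc]
  field_simp
  ring

/-- A finite measure whose characteristic function extends analytically to a neighbourhood of `0`
has a finite second moment. -/
theorem integrable_sq_of_charFun_eq_analyticAt {μ : Measure ℝ} [IsFiniteMeasure μ] {g : ℂ → ℂ}
    (hg : AnalyticAt ℂ g 0) (h : ∀ᶠ t : ℝ in 𝓝 0, charFun μ t = g (t * Complex.I)) :
    Integrable (fun x : ℝ => x ^ 2) μ := by
  have htI : Tendsto (fun t : ℝ => (t : ℂ) * Complex.I) (𝓝 0) (𝓝 0) := by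
    have : Continuous fun t : ℝ => (t : ℂ) * Complex.I := by fun_prop
    simpa using this.tendsto 0
  have hneg : Tendsto (fun t : ℝ => -t) (𝓝 0) (𝓝 0) := by
    simpa using (continuous_neg (G := ℝ)).tendsto 0
  obtain ⟨C, hC⟩ := ((isBigO_second_difference hg).comp_tendsto htI).bound
  have hb : ∀ᶠ t : ℝ in 𝓝[≠] 0,
      ∫⁻ x, ENNReal.ofReal (2 * (1 - Real.cos (t * x)) / t ^ 2) ∂μ ≤ ENNReal.ofReal C := by
    filter_upwards [nhdsWithin_le_nhds hC, nhdsWithin_le_nhds h,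
      nhdsWithin_le_nhds (hneg.eventually h), eventually_mem_nhdsWithin] with t hCt h1 h2 ht
    have ht2 : 0 < t ^ 2 := by have : t ≠ 0 := ht; positivity
    have h3 := charFun_second_difference μ t
    rw [h.self_of_nhds, h1, h2] at h3
    simp only [Function.comp_apply] at hCt
    have hz : ((0 : ℝ) : ℂ) * Complex.I = 0 := by simp
    have hm : ((-t : ℝ) : ℂ) * Complex.I = -(t * Complex.I) := by push_cast; ring
    rw [hz, hm] at h3
    rw [h3] at hCt
    simp only [Complex.norm_real, norm_mul, Complex.norm_I, mul_one, norm_pow,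
      Real.norm_eq_abs, sq_abs] at hCt
    rw [← ofReal_integral_eq_lintegral_ofReal ((integrable_one_sub_cos μ t).div_const _)
      (ae_of_all _ fun x => div_nonneg (by linarith [Real.cos_le_one (t * x)]) ht2.le),
      integral_div]
    refine ENNReal.ofReal_le_ofReal ?_
    rw [div_le_iff₀ ht2]
    exact (le_abs_self _).trans hCt
  -- Fatou as `t → 0`: the bound `C`, uniform in `t`, passes to the limit integrand `x²`.
  have hF := lintegral_liminf_le (μ := μ) (u := 𝓝[≠] (0 : ℝ))
    (f := fun t x => ENNReal.ofReal (2 * (1 - Real.cos (t * x)) / t ^ 2))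
    (fun t => by fun_prop)
  have hlim : ∀ x : ℝ, liminf (fun t : ℝ => ENNReal.ofReal (2 * (1 - Real.cos (t * x)) / t ^ 2))
      (𝓝[≠] 0) = ENNReal.ofReal (x ^ 2) := fun x =>
    (ENNReal.tendsto_ofReal (tendsto_second_difference_cos x)).liminf_eq
  simp only [hlim] at hF
  refine ⟨by fun_prop, ?_⟩
  rw [hasFiniteIntegral_iff_ofReal (ae_of_all _ fun x => sq_nonneg x)]
  refine hF.trans_lt (lt_of_le_of_lt ?_ (ENNReal.ofReal_lt_top (r := C)))
  exact liminf_le_of_frequently_le' hb.frequently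

theorem hasDerivAt_comp_mul_I {g : ℂ → ℂ} {t : ℝ} (hg : DifferentiableAt ℂ g (t * Complex.I)) :
    HasDerivAt (fun s : ℝ => g (s * Complex.I)) (deriv g (t * Complex.I) * Complex.I) t := by
  have h2 : HasDerivAt (fun s : ℝ => (s : ℂ) * Complex.I) Complex.I t := by
    simpa using (Complex.ofRealCLM.hasDerivAt (x := t)).mul_const Complex.I
  exact hg.hasDerivAt.comp t h2

/-- If the characteristic function of `μ` extends to an analytic function `g` near `0`, then the
second derivative of `g` extends that of the measure with density `x ^ 2`. -/
theorem charFun_withDensity_sq {μ : Measure ℝ} [IsFiniteMeasure μ] {g : ℂ → ℂ}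
    (hg : AnalyticAt ℂ g 0) (h : ∀ᶠ t : ℝ in 𝓝 0, charFun μ t = g (t * Complex.I)) :
    ∀ᶠ t : ℝ in 𝓝 0, charFun (μ.withDensity fun x => ENNReal.ofReal (x ^ 2)) t =
      deriv (deriv g) (t * Complex.I) := by
  have hint := integrable_sq_of_charFun_eq_analyticAt hg h
  have hmem : MemLp id (2 : ℕ) μ := by
    have := (memLp_two_iff_integrable_sq (f := (id : ℝ → ℝ)) (μ := μ) (by fun_prop)).2 hint
    exact_mod_cast this
  have htI : Tendsto (fun t : ℝ => (t : ℂ) * Complex.I) (𝓝 0) (𝓝 0) := by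
    have : Continuous fun t : ℝ => (t : ℂ) * Complex.I := by fun_prop
    simpa using this.tendsto 0
  have hd := htI.eventually hg.eventually_analyticAt
  have h1 : ∀ᶠ t : ℝ in 𝓝 0,
      deriv (charFun μ) t = deriv g (t * Complex.I) * Complex.I := by
    filter_upwards [h.eventually_nhds, hd] with t ht hdt
    rw [EventuallyEq.deriv_eq ht]
    exact (hasDerivAt_comp_mul_I hdt.differentiableAt).deriv
  filter_upwards [h1.eventually_nhds, hd] with t ht hdt
  -- Two derivatives along the imaginary axis give `I² = -1`, which cancels the `I²` in the moment
  -- formula.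
  have h2 : iteratedDeriv 2 (charFun μ) t = -deriv (deriv g) (t * Complex.I) := by
    rw [iteratedDeriv_succ, iteratedDeriv_one, EventuallyEq.deriv_eq ht,
      ((hasDerivAt_comp_mul_I hdt.deriv.differentiableAt).mul_const Complex.I).deriv, mul_assoc,
      Complex.I_mul_I]
    ring
  rw [iteratedDeriv_charFun hmem, Complex.I_sq, neg_one_mul, neg_inj] at h2
  rw [← h2, charFun_apply_real, integral_withDensity_eq_integral_toReal_smul (by fun_prop)
    (ae_of_all _ fun _ => ENNReal.ofReal_lt_top)]
  refine integral_congr_ae (ae_of_all _ fun x => ?_)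
  simp [ENNReal.toReal_ofReal (sq_nonneg x)]

/-- Induction on `k`: giving the measure the density `x²` replaces `g` by `g''`, and the new measure
is again finite. -/
theorem even_moment_of_charFun_eq_analyticAt (k : ℕ) {μ : Measure ℝ} [IsFiniteMeasure μ]
    {g : ℂ → ℂ} (hg : AnalyticAt ℂ g 0)
    (h : ∀ᶠ t : ℝ in 𝓝 0, charFun μ t = g (t * Complex.I)) :
    ∫⁻ x, ENNReal.ofReal (x ^ (2 * k)) ∂μ = ENNReal.ofReal ‖iteratedDeriv (2 * k) g 0‖ := by
  induction k generalizing μ g with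
  | zero =>
    have h0 := h.self_of_nhds
    simp only [charFun_zero, Complex.ofReal_zero, zero_mul] at h0
    simp [← h0, abs_of_nonneg measureReal_nonneg]
  | succ k ih =>
    have hint := integrable_sq_of_charFun_eq_analyticAt hg h
    have : IsFiniteMeasure (μ.withDensity fun x => ENNReal.ofReal (x ^ 2)) :=
      isFiniteMeasure_withDensity_ofReal hint.2
    have := ih hg.deriv.deriv (charFun_withDensity_sq hg h)
    rw [lintegral_withDensity_eq_lintegral_mul _ (by fun_prop) (by fun_prop)] at this
    rw [mul_add, mul_one, iteratedDeriv_succ', iteratedDeriv_succ', ← this]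
    refine lintegral_congr fun x => ?_
    rw [Pi.mul_apply, ← ENNReal.ofReal_mul (sq_nonneg x), ← pow_add, add_comm 2]

/-- A finite measure whose characteristic function extends analytically to a disc of radius `a`
has exponential moments of all orders below `a`. -/
theorem lintegral_exp_lt_top_of_charFun_eq_analyticOn {μ : Measure ℝ} [IsFiniteMeasure μ]
    {g : ℂ → ℂ} {a r : ℝ} (hr : 0 < r) (hra : r < a)
    (hg : AnalyticOnNhd ℂ g (Metric.ball 0 a))
    (h : ∀ᶠ t : ℝ in 𝓝 0, charFun μ t = g (t * Complex.I)) :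
    ∫⁻ x, ENNReal.ofReal (Real.exp (r * x)) ∂μ < ∞ := by
  -- Cauchy's estimates on the circle of radius `ρ` produce a geometric series of ratio `(r/ρ)² <
  -- 1`.
  obtain ⟨ρ, hrρ, hρa⟩ := exists_between hra
  have hρ : 0 < ρ := hr.trans hrρ
  have hsub : Metric.closedBall (0 : ℂ) ρ ⊆ Metric.ball 0 a := Metric.closedBall_subset_ball hρa
  obtain ⟨C, hC⟩ := (isCompact_closedBall (0 : ℂ) ρ).exists_bound_of_continuousOn
    (hg.continuousOn.mono hsub)
  have hC0 : 0 ≤ C := (norm_nonneg _).trans (hC 0 (Metric.mem_closedBall_self hρ.le))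
  have hcauchy : ∀ n, ‖iteratedDeriv n g 0‖ ≤ n.factorial * C / ρ ^ n := fun n =>
    Complex.norm_iteratedDeriv_le_of_forall_mem_sphere_norm_le n hρ
      (DifferentiableOn.diffContOnCl
        (by rw [closure_ball _ hρ.ne']; exact hg.differentiableOn.mono hsub))
      fun z hz => hC z (Metric.sphere_subset_closedBall hz)
  have hg0 : AnalyticAt ℂ g 0 := hg 0 (Metric.mem_ball_self (hρ.trans hρa))
  have hterm : ∀ k : ℕ, ∫⁻ x, ENNReal.ofReal ((r * x) ^ (2 * k) / (2 * k).factorial) ∂μ ≤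
      ENNReal.ofReal (C * ((r / ρ) ^ 2) ^ k) := fun k => by
    have h1 : ∀ x : ℝ, ENNReal.ofReal ((r * x) ^ (2 * k) / (2 * k).factorial) =
        ENNReal.ofReal (r ^ (2 * k) / (2 * k).factorial) * ENNReal.ofReal (x ^ (2 * k)) :=
      fun x => by
        rw [← ENNReal.ofReal_mul (by positivity)]
        congr 1
        ring
    simp only [h1]
    rw [lintegral_const_mul _ (by fun_prop), even_moment_of_charFun_eq_analyticAt k hg0 h,
      ← ENNReal.ofReal_mul (by positivity)]
    refine ENNReal.ofReal_le_ofReal ?_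
    refine (mul_le_mul_of_nonneg_left (hcauchy (2 * k)) (by positivity)).trans_eq ?_
    have : ((2 * k).factorial : ℝ) ≠ 0 := by positivity
    rw [← pow_mul, div_pow]
    field_simp
  have hq : (r / ρ) ^ 2 < 1 := by
    have : r / ρ < 1 := (div_lt_one hρ).2 hrρ
    have : 0 < r / ρ := by positivity
    nlinarith
  have hgeom : Summable fun k : ℕ => C * ((r / ρ) ^ 2) ^ k :=
    (summable_geometric_of_lt_one (by positivity) hq).mul_left C
  -- Since `exp y ≤ 2 cosh y`, even moments suffice; their terms are nonnegative, so sum and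
  -- integral commute.
  have hcosh : ∀ x : ℝ, ENNReal.ofReal (Real.exp (r * x)) ≤
      2 * ∑' k : ℕ, ENNReal.ofReal ((r * x) ^ (2 * k) / (2 * k).factorial) := fun x => by
    have hnn : ∀ k : ℕ, 0 ≤ (r * x) ^ (2 * k) / (2 * k).factorial := fun k => by
      rw [pow_mul]; positivity
    rw [← ENNReal.ofReal_tsum_of_nonneg hnn (Real.hasSum_cosh (r * x)).summable,
      (Real.hasSum_cosh (r * x)).tsum_eq, ← ENNReal.ofReal_ofNat,
      ← ENNReal.ofReal_mul zero_le_two]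
    refine ENNReal.ofReal_le_ofReal ?_
    rw [Real.cosh_eq]
    linarith [Real.exp_pos (-(r * x))]
  refine (lintegral_mono hcosh).trans_lt ?_
  rw [lintegral_const_mul _ (by fun_prop), lintegral_tsum fun k => by fun_prop]
  refine ENNReal.mul_lt_top (by simp) ((ENNReal.tsum_le_tsum hterm).trans_lt ?_)
  rw [← ENNReal.ofReal_tsum_of_nonneg (fun k => by positivity) hgeom]
  exact ENNReal.ofReal_lt_top

/-! ### Comparison of norms and positive semidefinite matrices. -/

theorem Seminorm.continuous_of_finiteDimensional {E : Type*} [NormedAddCommGroup E]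
    [NormedSpace ℝ E] [FiniteDimensional ℝ E] (N : Seminorm ℝ E) : Continuous N :=
  N.convexOn.locallyLipschitz.continuous

theorem Seminorm.exists_norm_le_mul {E : Type*} [NormedAddCommGroup E]
    [NormedSpace ℝ E] [FiniteDimensional ℝ E] (N : Seminorm ℝ E) (hN : ∀ x, N x = 0 → x = 0) :
    ∃ C, 0 ≤ C ∧ ∀ x, ‖x‖ ≤ C * N x := by
  -- The unit sphere is empty only in the zero space, as for `d = 0`; otherwise the constant is the
  -- inverse of the minimum of `N` on it.
  rcases (Metric.sphere (0 : E) 1).eq_empty_or_nonempty with h | h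
  · refine ⟨0, le_rfl, fun x => ?_⟩
    by_contra hx
    have hx : x ≠ 0 := fun h0 => by simp [h0] at hx
    have : ‖x‖⁻¹ • x ∈ Metric.sphere (0 : E) 1 := by
      simp [norm_smul, inv_mul_cancel₀ (norm_ne_zero_iff.2 hx)]
    rw [h] at this
    exact this
  · obtain ⟨x₀, hx₀, hmin⟩ := (isCompact_sphere (0 : E) 1).exists_isMinOn h
      N.continuous_of_finiteDimensional.continuousOn
    have hx₀' : x₀ ≠ 0 := ne_zero_of_mem_unit_sphere ⟨x₀, hx₀⟩
    have hpos : 0 < N x₀ := (apply_nonneg N x₀).lt_of_ne fun h => hx₀' (hN _ h.symm)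
    refine ⟨(N x₀)⁻¹, by positivity, fun x => ?_⟩
    rcases eq_or_ne x 0 with rfl | hx
    · simp
    have hx' : 0 < ‖x‖ := norm_pos_iff.2 hx
    have hmem : ‖x‖⁻¹ • x ∈ Metric.sphere (0 : E) 1 := by
      simp [norm_smul, inv_mul_cancel₀ hx'.ne']
    have h1 : N x₀ ≤ ‖x‖⁻¹ * N x := by
      simpa [map_smul_eq_mul] using isMinOn_iff.1 hmin _ hmem
    rw [inv_mul_eq_div, le_div_iff₀ hx'] at h1
    rw [inv_mul_eq_div, le_div_iff₀ hpos]
    linarith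

open scoped MatrixOrder in
theorem Matrix.PosSemidef.exists_eq_conjTranspose_mul_self {d : ℕ} {X : Matrix (Fin d) (Fin d) ℝ}
    (hX : X.PosSemidef) : ∃ B : Matrix (Fin d) (Fin d) ℝ, X = B.conjTranspose * B :=
  CStarAlgebra.nonneg_iff_eq_star_mul_self.1 hX.nonneg

/-- With `X = BᵀB`, cyclicity turns the trace into that of `B Y Bᵀ`. -/
theorem Matrix.PosSemidef.trace_mul_nonneg {d : ℕ} {X Y : Matrix (Fin d) (Fin d) ℝ}
    (hX : X.PosSemidef) (hY : Y.PosSemidef) : 0 ≤ (X * Y).trace := by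
  obtain ⟨B, rfl⟩ := hX.exists_eq_conjTranspose_mul_self
  rw [Matrix.mul_assoc, Matrix.trace_mul_comm]
  exact (hY.mul_mul_conjTranspose_same B).trace_nonneg

/-- With `X = BᵀB`, submultiplicativity gives `‖X‖ ≤ ‖B‖² = tr(BᵀB)`. -/
theorem Matrix.PosSemidef.frobenius_norm_le_trace {d : ℕ} {X : Matrix (Fin d) (Fin d) ℝ}
    (hX : X.PosSemidef) : ‖X‖ ≤ X.trace := by
  obtain ⟨B, rfl⟩ := hX.exists_eq_conjTranspose_mul_self
  refine (Matrix.frobenius_norm_mul _ _).trans_eq ?_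
  rw [Matrix.frobenius_norm_conjTranspose, Matrix.frobenius_norm_def, ← Real.sqrt_eq_rpow,
    Real.mul_self_sqrt (by positivity), Finset.sum_comm]
  simp [Matrix.trace, Matrix.mul_apply, sq]

theorem LinearMap.exists_norm_le_mul {E F : Type*} [NormedAddCommGroup E] [NormedSpace ℝ E]
    [FiniteDimensional ℝ E] [NormedAddCommGroup F] [NormedSpace ℝ F] (f : E →ₗ[ℝ] F) :
    ∃ C, 0 ≤ C ∧ ∀ x, ‖f x‖ ≤ C * ‖x‖ :=
  ⟨_, norm_nonneg f.toContinuousLinearMap, f.toContinuousLinearMap.le_opNorm⟩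

/-! ### The trace pairing and the geometry of the domain. -/

noncomputable section

/-- The continuous dual of a complex normed space, for the topology of its norm. -/
abbrev NormedDual (E : Type*) [NormedAddCommGroup E] [NormedSpace ℂ E] : Type _ := E →L[ℂ] ℂ

/-- The pairing `(X, Z) ↦ tr(X Z)` of real with complex matrices. -/
def tracePairing (d : ℕ) :
    Matrix (Fin d) (Fin d) ℝ →ₗ[ℝ] NormedDual (Matrix (Fin d) (Fin d) ℂ) where
  toFun X := LinearMap.toContinuousLinearMap
    (Matrix.traceLinearMap (Fin d) ℂ ℂ ∘ₗ LinearMap.mulLeft ℂ (toComplexMatrix X))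
  map_add' X Y := by
    refine ContinuousLinearMap.ext fun Z => ?_
    have : toComplexMatrix (X + Y) = toComplexMatrix X + toComplexMatrix Y := by
      ext; simp [toComplexMatrix]
    simp [this, add_mul]
  map_smul' c X := by
    refine ContinuousLinearMap.ext fun Z => ?_
    have : toComplexMatrix (c • X) = c • toComplexMatrix X := by
      ext; simp [toComplexMatrix]
    simp [this]

end

theorem tracePairing_apply {d : ℕ} (X : Matrix (Fin d) (Fin d) ℝ)
    (Z : Matrix (Fin d) (Fin d) ℂ) :
    tracePairing d X Z = (toComplexMatrix X * Z).trace := rfl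

theorem re_tracePairing {d : ℕ} (X : Matrix (Fin d) (Fin d) ℝ)
    (Z : Matrix (Fin d) (Fin d) ℂ) :
    (tracePairing d X Z).re = (X * Z.map Complex.re).trace := by
  simp [tracePairing_apply, Matrix.trace, Matrix.mul_apply, toComplexMatrix]

theorem tracePairing_toComplexMatrix {d : ℕ} (X R : Matrix (Fin d) (Fin d) ℝ) :
    tracePairing d X (toComplexMatrix R) = ((R * X).trace : ℝ) := by
  rw [Matrix.trace_mul_comm]
  simp [tracePairing_apply, Matrix.trace, Matrix.mul_apply, toComplexMatrix]

theorem isOpen_stripMinusCone {d : ℕ} (N : Seminorm ℝ (Matrix (Fin d) (Fin d) ℝ)) (ε : ℝ) :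
    IsOpen (stripMinusCone N ε) := by
  refine IsOpen.sub_right ?_
  refine isOpen_lt (N.continuous_of_finiteDimensional.comp ?_) continuous_const
  exact Continuous.matrix_map continuous_id Complex.continuous_re

theorem convex_stripMinusCone {d : ℕ} (N : Seminorm ℝ (Matrix (Fin d) (Fin d) ℝ)) (ε : ℝ) :
    Convex ℝ (stripMinusCone N ε) := by
  refine Convex.sub ?_ ?_
  · intro Z hZ W hW a b ha hb hab
    have h : (a • Z + b • W).map Complex.re = a • Z.map Complex.re + b • W.map Complex.re := by
      ext; simp
    have hmem := N.convex_ball 0 ε ((N.mem_ball_zero).2 hZ) ((N.mem_ball_zero).2 hW) ha hb hab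
    rw [N.mem_ball_zero, ← h] at hmem
    exact hmem
  · rintro _ ⟨X, hX, rfl⟩ _ ⟨Y, hY, rfl⟩ a b ha hb -
    refine ⟨a • X + b • Y, (hX.smul ha).add (hY.smul hb), ?_⟩
    ext; simp [toComplexMatrix]

theorem continuous_tracePairing (d : ℕ) : Continuous (tracePairing d) :=
  LinearMap.continuous_of_finiteDimensional _

/-- Moving along the identity multiplies `exp(Re tr(XZ))` by `exp(δ tr X)`, the room needed to
dominate the Taylor series. -/
theorem add_real_smul_one_mem_stripMinusCone {d : ℕ}
    {N : Seminorm ℝ (Matrix (Fin d) (Fin d) ℝ)} {ε : ℝ} {Z : Matrix (Fin d) (Fin d) ℂ}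
    (hZ : Z ∈ stripMinusCone N ε) :
    ∃ δ : ℝ, 0 < δ ∧ Z + (δ : ℂ) • 1 ∈ stripMinusCone N ε := by
  have hc : Continuous fun δ : ℝ => Z + (δ : ℂ) • (1 : Matrix (Fin d) (Fin d) ℂ) := by fun_prop
  have h : ∀ᶠ δ : ℝ in 𝓝 0, Z + (δ : ℂ) • 1 ∈ stripMinusCone N ε :=
    hc.continuousAt.eventually_mem ((isOpen_stripMinusCone N ε).mem_nhds (by simpa using hZ))
  have h' : ∀ᶠ δ : ℝ in 𝓝[>] 0, Z + (δ : ℂ) • 1 ∈ stripMinusCone N ε := nhdsWithin_le_nhds h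
  obtain ⟨δ, hδ, hpos⟩ := (h'.and eventually_mem_nhdsWithin).exists
  exact ⟨δ, hpos, hδ⟩

theorem re_tracePairing_add_real_smul_one {d : ℕ} (X : Matrix (Fin d) (Fin d) ℝ)
    (Z : Matrix (Fin d) (Fin d) ℂ) (δ : ℝ) :
    (tracePairing d X (Z + (δ : ℂ) • 1)).re = (tracePairing d X Z).re + δ * X.trace := by
  rw [map_add, map_smul, Complex.add_re, smul_eq_mul, Complex.re_ofReal_mul, re_tracePairing X 1]
  congr 3
  have : (1 : Matrix (Fin d) (Fin d) ℂ).map Complex.re = 1 := by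
    ext i j; by_cases h : i = j <;> simp [Matrix.one_apply, h]
  rw [this, Matrix.mul_one]

theorem re_tracePairing_sub_le {d : ℕ} {X P : Matrix (Fin d) (Fin d) ℝ} (hX : X.PosSemidef)
    (hP : P.PosSemidef) (W : Matrix (Fin d) (Fin d) ℂ) :
    (tracePairing d X (W - toComplexMatrix P)).re ≤ (W.map Complex.re * X).trace := by
  rw [map_sub, Complex.sub_re, re_tracePairing X W, tracePairing_toComplexMatrix,
    Complex.ofReal_re, Matrix.trace_mul_comm X]
  linarith [hP.trace_mul_nonneg hX]

theorem Complex.norm_exp_sub_one_le_mul_exp (w : ℂ) :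
    ‖Complex.exp w - 1‖ ≤ ‖w‖ * Real.exp ‖w‖ := by
  simpa using Complex.norm_exp_sub_sum_le_norm_mul_exp w 1

theorem Real.exp_sub_one_le_mul_exp (t : ℝ) : Real.exp t - 1 ≤ t * Real.exp t := by
  have h := Real.add_one_le_exp (-t)
  have h' : Real.exp (-t) * Real.exp t = 1 := by rw [← Real.exp_add]; simp
  nlinarith [Real.exp_pos t]

/-! ### Integrability against the Lévy measure. -/

section

variable {d : ℕ} {N : Seminorm ℝ (Matrix (Fin d) (Fin d) ℝ)}
  {κ : Measure (Matrix (Fin d) (Fin d) ℝ)}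

theorem continuous_seminorm_matrix (N : Seminorm ℝ (Matrix (Fin d) (Fin d) ℝ)) : Continuous N :=
  N.continuous_of_finiteDimensional

theorem measurableSet_one_le_seminorm (N : Seminorm ℝ (Matrix (Fin d) (Fin d) ℝ)) :
    MeasurableSet {X | 1 ≤ N X} :=
  measurableSet_le measurable_const (continuous_seminorm_matrix N).measurable

theorem continuous_re_tracePairing (Z : Matrix (Fin d) (Fin d) ℂ) :
    Continuous fun X => (tracePairing d X Z).re := by
  have : Continuous fun l : NormedDual (Matrix (Fin d) (Fin d) ℂ) => (l Z).re := by fun_prop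
  exact this.comp (continuous_tracePairing d)

theorem continuous_cexp_tracePairing (Z : Matrix (Fin d) (Fin d) ℂ) :
    Continuous fun X => Complex.exp (tracePairing d X Z) := by
  have : Continuous fun l : NormedDual (Matrix (Fin d) (Fin d) ℂ) => Complex.exp (l Z) := by
    fun_prop
  exact this.comp (continuous_tracePairing d)

theorem exists_norm_tracePairing_le (hN : ∀ X, N X = 0 → X = 0) :
    ∃ C, 0 ≤ C ∧ ∀ X, ‖tracePairing d X‖ ≤ C * N X := by
  obtain ⟨C₁, hC₁, h₁⟩ := N.exists_norm_le_mul hN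
  obtain ⟨C₂, hC₂, h₂⟩ := (tracePairing d).exists_norm_le_mul
  refine ⟨C₂ * C₁, by positivity, fun X => (h₂ X).trans ?_⟩
  rw [mul_assoc]
  exact mul_le_mul_of_nonneg_left (h₁ X) hC₂

theorem exists_norm_tracePairing_le_trace (d : ℕ) :
    ∃ C, 0 < C ∧ ∀ X : Matrix (Fin d) (Fin d) ℝ, X.PosSemidef →
      ‖tracePairing d X‖ ≤ C * X.trace := by
  obtain ⟨C, hC, h⟩ := (tracePairing d).exists_norm_le_mul
  -- The `+ 1` makes the constant strictly positive, so that it can later be divided by.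
  refine ⟨C + 1, by positivity, fun X hX => (h X).trans ?_⟩
  have h₁ := hX.frobenius_norm_le_trace
  have h₂ := norm_nonneg X
  nlinarith

/-- Near the origin `exp(tr(X Z)) - 1` is integrable, whatever `Z`. -/
theorem integrable_cexp_sub_one_of_le_one (hN : ∀ X, N X = 0 → X = 0)
    (h₁ : ∀ᵐ X ∂κ, N X ≤ 1) (hint : Integrable N κ) (Z : Matrix (Fin d) (Fin d) ℂ) :
    Integrable (fun X => Complex.exp (tracePairing d X Z) - 1) κ := by
  obtain ⟨C, hC, h⟩ := exists_norm_tracePairing_le hN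
  refine (hint.const_mul (C * ‖Z‖ * Real.exp (C * ‖Z‖))).mono'
    ((continuous_cexp_tracePairing Z).sub continuous_const).aestronglyMeasurable ?_
  filter_upwards [h₁] with X hX
  have hb : ‖tracePairing d X Z‖ ≤ C * ‖Z‖ * N X :=
    ((tracePairing d X).le_opNorm Z).trans
      ((mul_le_mul_of_nonneg_right (h X) (norm_nonneg Z)).trans_eq (by ring))
  have hb' : ‖tracePairing d X Z‖ ≤ C * ‖Z‖ :=
    hb.trans (mul_le_of_le_one_right (by positivity) hX)
  calc _ ≤ _ := Complex.norm_exp_sub_one_le_mul_exp _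
    _ ≤ (C * ‖Z‖ * N X) * Real.exp (C * ‖Z‖) := by
      have := apply_nonneg N X
      gcongr
    _ = _ := by ring

theorem integrable_exp_mul_exp_sub_one_of_le_one (hN : ∀ X, N X = 0 → X = 0)
    (h₁ : ∀ᵐ X ∂κ, N X ≤ 1) (hint : Integrable N κ) (Z : Matrix (Fin d) (Fin d) ℂ)
    {c : ℝ} (hc : 0 ≤ c) :
    Integrable (fun X => Real.exp (tracePairing d X Z).re *
      (Real.exp (c * ‖tracePairing d X‖) - 1)) κ := by
  obtain ⟨C, hC, h⟩ := exists_norm_tracePairing_le hN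
  have hcont : Continuous fun l : NormedDual (Matrix (Fin d) (Fin d) ℂ) =>
      Real.exp (l Z).re * (Real.exp (c * ‖l‖) - 1) := by fun_prop
  refine (hint.const_mul (Real.exp (C * ‖Z‖) * (c * C * Real.exp (c * C)))).mono'
    (hcont.comp (continuous_tracePairing d)).aestronglyMeasurable ?_
  filter_upwards [h₁] with X hX
  have hb : ‖tracePairing d X‖ ≤ C := (h X).trans (mul_le_of_le_one_right hC hX)
  have hre : (tracePairing d X Z).re ≤ C * ‖Z‖ :=
    (Complex.re_le_norm _).trans (((tracePairing d X).le_opNorm Z).trans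
      (mul_le_mul_of_nonneg_right hb (norm_nonneg Z)))
  have hexp : 0 ≤ Real.exp (c * ‖tracePairing d X‖) - 1 :=
    sub_nonneg.2 (Real.one_le_exp (by positivity))
  rw [Real.norm_of_nonneg (mul_nonneg (Real.exp_nonneg _) hexp)]
  calc _ ≤ Real.exp (C * ‖Z‖) *
        ((c * ‖tracePairing d X‖) * Real.exp (c * ‖tracePairing d X‖)) := by
        gcongr
        exact Real.exp_sub_one_le_mul_exp _
    _ ≤ Real.exp (C * ‖Z‖) * ((c * (C * N X)) * Real.exp (c * C)) := by
      have := apply_nonneg N X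
      gcongr
      exact h X
    _ = _ := by ring

theorem measure_one_le_seminorm_lt_top (hsq : ∫⁻ X, ENNReal.ofReal (min 1 (N X ^ 2)) ∂κ < ∞) :
    κ {X | 1 ≤ N X} < ∞ := by
  refine lt_of_le_of_lt ?_ hsq
  rw [← setLIntegral_one]
  refine (setLIntegral_mono' (measurableSet_one_le_seminorm N) fun X (hX : 1 ≤ N X) => ?_).trans
    (setLIntegral_le_lintegral _ _)
  rw [min_eq_left (one_le_pow₀ hX), ENNReal.ofReal_one]

theorem integrable_seminorm_restrict_compl
    (hsmall : ∫⁻ X in {X | N X ≤ 1}, ENNReal.ofReal (N X) ∂κ < ∞) :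
    Integrable N (κ.restrict {X | 1 ≤ N X}ᶜ) := by
  refine ⟨(continuous_seminorm_matrix N).aestronglyMeasurable, ?_⟩
  rw [hasFiniteIntegral_iff_ofReal (ae_of_all _ fun X => apply_nonneg N X)]
  refine lt_of_le_of_lt (lintegral_mono_set fun X hX => ?_) hsmall
  simp only [Set.mem_compl_iff, Set.mem_ofPred_eq, not_le] at hX ⊢
  exact hX.le

theorem ae_restrict_compl_le_one (N : Seminorm ℝ (Matrix (Fin d) (Fin d) ℝ))
    (κ : Measure (Matrix (Fin d) (Fin d) ℝ)) :
    ∀ᵐ X ∂κ.restrict {X | 1 ≤ N X}ᶜ, N X ≤ 1 := by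
  filter_upwards [ae_restrict_mem (measurableSet_one_le_seminorm N).compl] with X hX
  simp only [Set.mem_compl_iff, Set.mem_ofPred_eq, not_le] at hX
  exact hX.le

theorem integrable_of_restrict_compl {α F : Type*} [MeasurableSpace α] [NormedAddCommGroup F]
    {μ : Measure α} {s : Set α} (hs : MeasurableSet s) {f : α → F}
    (h : Integrable f (μ.restrict s)) (h' : Integrable f (μ.restrict sᶜ)) : Integrable f μ := by
  rw [← Measure.restrict_add_restrict_compl (μ := μ) hs]
  exact h.add_measure h'

theorem FiniteExpMoments.integrable_exp_re {ε : ℝ} (hfin : FiniteExpMoments N κ ε)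
    (hpsd : ∀ᵐ X ∂κ, X.PosSemidef) {Z : Matrix (Fin d) (Fin d) ℂ}
    (hZ : Z ∈ stripMinusCone N ε) :
    Integrable (fun X => Real.exp (tracePairing d X Z).re) (κ.restrict {X | 1 ≤ N X}) := by
  obtain ⟨W, hW, _, ⟨P, hP, rfl⟩, rfl⟩ := hZ
  refine ⟨(Real.continuous_exp.comp (continuous_re_tracePairing _)).aestronglyMeasurable, ?_⟩
  rw [hasFiniteIntegral_iff_ofReal (ae_of_all _ fun X => Real.exp_nonneg _)]
  refine lt_of_le_of_lt (lintegral_mono_ae ?_) (hfin _ hW)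
  filter_upwards [ae_restrict_of_ae hpsd] with X hX
  exact ENNReal.ofReal_le_ofReal (Real.exp_le_exp.2 (re_tracePairing_sub_le hX hP W))

theorem integrable_cexp_sub_one (hN : ∀ X, N X = 0 → X = 0)
    (hsq : ∫⁻ X, ENNReal.ofReal (min 1 (N X ^ 2)) ∂κ < ∞)
    (hsmall : ∫⁻ X in {X | N X ≤ 1}, ENNReal.ofReal (N X) ∂κ < ∞)
    {Z : Matrix (Fin d) (Fin d) ℂ}
    (hZ : Integrable (fun X => Real.exp (tracePairing d X Z).re) (κ.restrict {X | 1 ≤ N X})) :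
    Integrable (fun X => Complex.exp (tracePairing d X Z) - 1) κ := by
  have : IsFiniteMeasure (κ.restrict {X | 1 ≤ N X}) :=
    ⟨by simpa using measure_one_le_seminorm_lt_top hsq⟩
  refine integrable_of_restrict_compl (measurableSet_one_le_seminorm N) ?_
    (integrable_cexp_sub_one_of_le_one hN (ae_restrict_compl_le_one N κ)
      (integrable_seminorm_restrict_compl hsmall) Z)
  refine Integrable.sub ?_ (integrable_const 1)
  refine hZ.mono' (continuous_cexp_tracePairing Z).aestronglyMeasurable (ae_of_all _ fun X => ?_)
  rw [Complex.norm_exp]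

theorem analyticAt_integral_tracePairing (hN : ∀ X, N X = 0 → X = 0)
    (hsq : ∫⁻ X, ENNReal.ofReal (min 1 (N X ^ 2)) ∂κ < ∞)
    (hsmall : ∫⁻ X in {X | N X ≤ 1}, ENNReal.ofReal (N X) ∂κ < ∞)
    (hpsd : ∀ᵐ X ∂κ, X.PosSemidef) {ε : ℝ} (hfin : FiniteExpMoments N κ ε)
    {Z : Matrix (Fin d) (Fin d) ℂ} (hZ : Z ∈ stripMinusCone N ε) :
    AnalyticAt ℂ (fun W => ∫ X, (Complex.exp (tracePairing d X W) - 1) ∂κ) Z := by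
  obtain ⟨δ, hδ, hZδ⟩ := add_real_smul_one_mem_stripMinusCone hZ
  obtain ⟨C, hC, hCle⟩ := exists_norm_tracePairing_le_trace d
  -- With this radius `c`, `c ‖tr(X ·)‖ ≤ δ tr X` on the cone.
  have hc : 0 < δ / C := by positivity
  refine analyticAt_integral_cexp_sub_one (ℓ := fun X => tracePairing d X)
    (continuous_tracePairing d).aestronglyMeasurable hc
    (integrable_cexp_sub_one hN hsq hsmall (hfin.integrable_exp_re hpsd hZ)) ?_
  refine integrable_of_restrict_compl (measurableSet_one_le_seminorm N) ?_
    (integrable_exp_mul_exp_sub_one_of_le_one hN (ae_restrict_compl_le_one N κ)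
      (integrable_seminorm_restrict_compl hsmall) Z hc.le)
  have hcont : Continuous fun l : NormedDual (Matrix (Fin d) (Fin d) ℂ) =>
      Real.exp (l Z).re * (Real.exp (δ / C * ‖l‖) - 1) := by fun_prop
  refine (hfin.integrable_exp_re hpsd hZδ).mono'
    (hcont.comp (continuous_tracePairing d)).aestronglyMeasurable ?_
  filter_upwards [ae_restrict_of_ae hpsd] with X hX
  have hexp : 0 ≤ Real.exp (δ / C * ‖tracePairing d X‖) - 1 :=
    sub_nonneg.2 (Real.one_le_exp (by positivity))
  rw [Real.norm_of_nonneg (mul_nonneg (Real.exp_nonneg _) hexp),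
    re_tracePairing_add_real_smul_one, Real.exp_add]
  refine mul_le_mul_of_nonneg_left ?_ (Real.exp_nonneg _)
  have hle : δ / C * ‖tracePairing d X‖ ≤ δ * X.trace := by
    refine (mul_le_mul_of_nonneg_left (hCle X hX) hc.le).trans_eq ?_
    field_simp
  linarith [Real.exp_le_exp.2 hle]

end

/-! ### The two nontrivial implications and the theorem. -/

section

variable {d : ℕ} {N : Seminorm ℝ (Matrix (Fin d) (Fin d) ℝ)}
  {γ : Matrix (Fin d) (Fin d) ℝ} {κ : Measure (Matrix (Fin d) (Fin d) ℝ)}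

theorem cumulantTransform_eq_tracePairing (hpsd : ∀ᵐ X ∂κ, X.PosSemidef)
    (Z : Matrix (Fin d) (Fin d) ℂ) :
    cumulantTransform γ κ Z =
      tracePairing d γ Z + ∫ X, (Complex.exp (tracePairing d X Z) - 1) ∂κ := by
  have h : κ.restrict {X : Matrix (Fin d) (Fin d) ℝ | X.PosSemidef} = κ :=
    Measure.restrict_eq_self_of_ae_mem hpsd
  rw [cumulantTransform, h]
  rfl

theorem smul_toComplexMatrix_mem_stripMinusCone {ε : ℝ} {R : Matrix (Fin d) (Fin d) ℝ} {z : ℂ}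
    (h : |z.re| * N R < ε) : z • toComplexMatrix R ∈ stripMinusCone N ε := by
  refine ⟨z • toComplexMatrix R, ?_, 0, ⟨0, Matrix.PosSemidef.zero, ?_⟩, sub_zero _⟩
  · have : (z • toComplexMatrix R).map Complex.re = z.re • R := by
      ext; simp [toComplexMatrix]
    rw [Set.mem_ofPred_eq, this, map_smul_eq_mul, Real.norm_eq_abs]
    exact h
  · ext; simp [toComplexMatrix]

theorem tracePairing_smul_toComplexMatrix (X R : Matrix (Fin d) (Fin d) ℝ) (z : ℂ) :
    tracePairing d X (z • toComplexMatrix R) = z * ((R * X).trace : ℝ) := by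
  rw [map_smul, tracePairing_toComplexMatrix, smul_eq_mul]

theorem FiniteExpMoments.cumulantAnalyticOn (hN : ∀ X, N X = 0 → X = 0)
    (hsq : ∫⁻ X, ENNReal.ofReal (min 1 (N X ^ 2)) ∂κ < ∞)
    (hsmall : ∫⁻ X in {X | N X ≤ 1}, ENNReal.ofReal (N X) ∂κ < ∞)
    (hpsd : ∀ᵐ X ∂κ, X.PosSemidef) {ε : ℝ} (hfin : FiniteExpMoments N κ ε) :
    CumulantAnalyticOn γ κ (stripMinusCone N ε) := by
  refine ⟨fun Z hZ => Integrable.integrableOn ?_, fun Z hZ => ?_⟩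
  · exact integrable_cexp_sub_one hN hsq hsmall (hfin.integrable_exp_re hpsd hZ)
  · rw [funext (cumulantTransform_eq_tracePairing hpsd)]
    exact ((tracePairing d γ).analyticAt Z).add
      (analyticAt_integral_tracePairing hN hsq hsmall hpsd hfin hZ)

theorem CumulantExtendsAnalyticallyTo.finiteExpMoments (hN : ∀ X, N X = 0 → X = 0)
    (hsq : ∫⁻ X, ENNReal.ofReal (min 1 (N X ^ 2)) ∂κ < ∞)
    (hsmall : ∫⁻ X in {X | N X ≤ 1}, ENNReal.ofReal (N X) ∂κ < ∞)
    (hpsd : ∀ᵐ X ∂κ, X.PosSemidef) {ε : ℝ}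
    (hext : CumulantExtendsAnalyticallyTo γ κ (stripMinusCone N ε)) :
    FiniteExpMoments N κ ε := by
  intro R hR
  obtain ⟨F, hF, hFeq⟩ := hext
  -- The strict inequality `N R < ε` leaves room for a disc containing the point `1`, where the
  -- exponential moment is wanted.
  obtain ⟨a, ha1, haR⟩ : ∃ a : ℝ, 1 < a ∧ a * N R < ε := by
    have h : ∀ᶠ a : ℝ in 𝓝[>] 1, a * N R < ε := by
      have hc : Continuous fun a : ℝ => a * N R := by fun_prop
      exact nhdsWithin_le_nhds (hc.continuousAt.eventually_lt_const (by simpa using hR))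
    obtain ⟨a, h1, h2⟩ := (h.and eventually_mem_nhdsWithin).exists
    exact ⟨a, h2, h1⟩
  have hA := measurableSet_one_le_seminorm N
  have hfinA : IsFiniteMeasure (κ.restrict {X | 1 ≤ N X}) :=
    ⟨by simpa using measure_one_le_seminorm_lt_top hsq⟩
  have hTm : Measurable fun X : Matrix (Fin d) (Fin d) ℝ => (R * X).trace := by
    have : Continuous fun X : Matrix (Fin d) (Fin d) ℝ => (R * X).trace := by fun_prop
    exact this.measurable
  set small : Matrix (Fin d) (Fin d) ℂ → ℂ := fun Z =>
    ∫ X in {X | 1 ≤ N X}ᶜ, (Complex.exp (tracePairing d X Z) - 1) ∂κ with hsmalldef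
  have hsmallan : ∀ Z, AnalyticAt ℂ small Z := fun Z =>
    analyticAt_integral_cexp_sub_one (ℓ := fun X => tracePairing d X)
      (continuous_tracePairing d).aestronglyMeasurable one_pos
      (integrable_cexp_sub_one_of_le_one hN (ae_restrict_compl_le_one N κ)
        (integrable_seminorm_restrict_compl hsmall) Z)
      (integrable_exp_mul_exp_sub_one_of_le_one hN (ae_restrict_compl_le_one N κ)
        (integrable_seminorm_restrict_compl hsmall) Z zero_le_one)
  -- The added mass undoes the `-1` in the integrand over the large jumps.
  set G : Matrix (Fin d) (Fin d) ℂ → ℂ := fun Z =>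
    F Z - tracePairing d γ Z - small Z + κ.real {X | 1 ≤ N X} with hG
  have hGan : AnalyticOnNhd ℂ (fun z : ℂ => G (z • toComplexMatrix R)) (Metric.ball 0 a) := by
    intro z hz
    have hmem : z • toComplexMatrix R ∈ stripMinusCone N ε := by
      refine smul_toComplexMatrix_mem_stripMinusCone (lt_of_le_of_lt ?_ haR)
      refine mul_le_mul_of_nonneg_right ?_ (apply_nonneg N R)
      exact (Complex.abs_re_le_norm z).trans (mem_ball_zero_iff.1 hz).le
    have hGZ : AnalyticAt ℂ G (z • toComplexMatrix R) :=
      (((hF _ hmem).sub ((tracePairing d γ).analyticAt _)).sub (hsmallan _)).add analyticAt_const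
    have hlin : AnalyticAt ℂ (fun w : ℂ => w • toComplexMatrix R) z :=
      analyticAt_id.smul analyticAt_const
    exact hGZ.comp_of_eq hlin rfl
  have hchar : ∀ t : ℝ, charFun ((κ.restrict {X | 1 ≤ N X}).map fun X => (R * X).trace) t =
      G ((t * Complex.I) • toComplexMatrix R) := fun t => by
    have hZ : (t * Complex.I) • toComplexMatrix R = Complex.I • toComplexMatrix (t • R) := by
      ext; simp [toComplexMatrix]; ring
    have hnorm : ∀ X, ‖Complex.exp (tracePairing d X ((t * Complex.I) • toComplexMatrix R))‖ = 1 :=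
      fun X => by
        rw [tracePairing_smul_toComplexMatrix, mul_right_comm, ← Complex.ofReal_mul,
          Complex.norm_exp_ofReal_mul_I]
    have hintA : Integrable (fun X => Complex.exp
        (tracePairing d X ((t * Complex.I) • toComplexMatrix R))) (κ.restrict {X | 1 ≤ N X}) :=
      (integrable_const (1 : ℝ)).mono' (continuous_cexp_tracePairing _).aestronglyMeasurable
        (ae_of_all _ fun X => (hnorm X).le)
    have hint : Integrable (fun X => Complex.exp
        (tracePairing d X ((t * Complex.I) • toComplexMatrix R)) - 1) κ :=
      integrable_cexp_sub_one hN hsq hsmall (by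
        simpa only [Complex.norm_exp] using hintA.norm)
    have hsplit := integral_add_compl hA hint
    rw [integral_sub hintA (integrable_const 1)] at hsplit
    simp only [hG]
    rw [hZ, hFeq, ← hZ, cumulantTransform_eq_tracePairing hpsd, ← hsplit, charFun_apply_real,
      integral_map hTm.aemeasurable (by fun_prop)]
    simp only [hsmalldef, integral_const, measureReal_restrict_apply_univ]
    simp only [tracePairing_smul_toComplexMatrix, mul_right_comm (t : ℂ) Complex.I]
    simp
  have hexp := lintegral_exp_lt_top_of_charFun_eq_analyticOn one_pos ha1 hGan
    (Eventually.of_forall hchar)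
  rw [lintegral_map (by fun_prop) hTm] at hexp
  simpa only [one_mul] using hexp

end

theorem lemma2p5 {d : ℕ} {Ω : Type*} [MeasurableSpace Ω] (P : Measure Ω) [IsProbabilityMeasure P]
    -- an arbitrary norm on the real matrices
    (N : Seminorm ℝ (Matrix (Fin d) (Fin d) ℝ)) (hN : ∀ X, N X = 0 → X = 0)
    (L : ℝ≥0 → Ω → Matrix (Fin d) (Fin d) ℝ) (hL : IsMatrixSubordinator L P)
    (γ : Matrix (Fin d) (Fin d) ℝ) (κ : Measure (Matrix (Fin d) (Fin d) ℝ))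
    (hγκ : HasDriftAndLevyMeasure N L P γ κ)
    (ε : ℝ) (hε : 0 < ε) :
    IsOpen (stripMinusCone N ε) ∧ Convex ℝ (stripMinusCone N ε) ∧
      (CumulantAnalyticOn γ κ (stripMinusCone N ε) ↔ FiniteExpMoments N κ ε) ∧
      (CumulantExtendsAnalyticallyTo γ κ (stripMinusCone N ε) ↔ FiniteExpMoments N κ ε) := by
  have hpsd : ∀ᵐ X ∂κ, X.PosSemidef := hγκ.levy_posSemidef
  have h₁ : FiniteExpMoments N κ ε → CumulantAnalyticOn γ κ (stripMinusCone N ε) :=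
    FiniteExpMoments.cumulantAnalyticOn hN hγκ.levy_sq hγκ.levy_small hpsd
  have h₂ : CumulantAnalyticOn γ κ (stripMinusCone N ε) →
      CumulantExtendsAnalyticallyTo γ κ (stripMinusCone N ε) := fun h =>
    ⟨cumulantTransform γ κ, h.2, fun _ => rfl⟩
  have h₃ : CumulantExtendsAnalyticallyTo γ κ (stripMinusCone N ε) → FiniteExpMoments N κ ε :=
    CumulantExtendsAnalyticallyTo.finiteExpMoments hN hγκ.levy_sq hγκ.levy_small hpsd
  exact ⟨isOpen_stripMinusCone N ε, convex_stripMinusCone N ε,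
    ⟨fun h => h₃ (h₂ h), h₁⟩, ⟨h₃, fun h => h₂ (h₁ h)⟩⟩
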